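/- Let $A$ be a (complex, not necessarily unital) C*-algebra. A Banach $A$-bimodule is a complex Banach space $X$ with commuting left and right actions of $A$ that are bounded bilinear maps; it is essential if the linear span of $\{ax : a\in A, x\in X\}$ and the linear span of $\{xa : a\in A, x\in X\}$ are both dense in $X$. Its dual $X^*$ is a Banach $A$-bimodule under $(a x^*)(x)=x^*(xa)$ and $(x^*a)(x)=x^*(ax)$. A bounded linear operator $D\colon A\to X^*$ is hyperlocal if, for all $a,b,c\in A$, $ab=bc=0$ implies $aD(b)c=0$; it is a derivation if $D(ab)=aD(b)+D(a)b$ for all $a,b\in A$, and an inner derivation if there is $x^*\in X^*$ with $D(a)=ax^*-x^*a$ for all $a\in A$. The algebra $A$ is amenable if, for every Banach $A$-bimodule $X$, every bounded derivation $D\colon A\to X^*$ is inner. Corollary. $A$ is amenable if and only if, for every essential Banach $A$-bimodule $X$ and every bounded hyperlocal operator $D\colon A\to X^*$, there are $x^*,y^*\in X^*$ such that $D(a)=ax^*-y^*a$ for all $a\in A$. -/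

import Mathlib

universe u

/-- The structure of a Banach `A`-bimodule on a Banach space `X`: commuting left and right actions
of `A` on `X` which are jointly bounded bilinear maps. No unitality is required. -/
structure BanachBimodule (A X : Type*) [NonUnitalNormedRing A] [NormedSpace ℂ A]
    [NormedAddCommGroup X] [NormedSpace ℂ X] where
  /-- The left action, `left a x = a x`. -/
  left : A →L[ℂ] X →L[ℂ] X
  /-- The right action, `right a x = x a`. -/
  right : A →L[ℂ] X →L[ℂ] X
  left_mul : ∀ (a b : A) (x : X), left (a * b) x = left a (left b x)
  right_mul : ∀ (a b : A) (x : X), right (a * b) x = right b (right a x)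
  left_right : ∀ (a b : A) (x : X), left a (right b x) = right b (left a x)

namespace BanachBimodule

variable {A X : Type*} [NonUnitalNormedRing A] [NormedSpace ℂ A]
  [NormedAddCommGroup X] [NormedSpace ℂ X]

/-- `X` is an essential bimodule: the products `a x` span a dense subspace of `X`, and so do the
products `x a`. -/
def IsEssential (M : BanachBimodule A X) : Prop :=
  Dense (Submodule.span ℂ {y : X | ∃ (a : A) (x : X), y = M.left a x} : Set X) ∧
    Dense (Submodule.span ℂ {y : X | ∃ (a : A) (x : X), y = M.right a x} : Set X)

/-- The dual bimodule `X*`, with the actions `(a f)(x) = f (x a)` and `(f a)(x) = f (a x)`. -/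
noncomputable def dual (M : BanachBimodule A X) : BanachBimodule A (StrongDual ℂ X) where
  left := ((ContinuousLinearMap.compL ℂ X X ℂ).flip).comp M.right
  right := ((ContinuousLinearMap.compL ℂ X X ℂ).flip).comp M.left
  left_mul a b f := by ext x; simp [M.right_mul]
  right_mul a b f := by ext x; simp [M.left_mul]
  left_right a b f := by ext x; simp [M.left_right]

@[simp] theorem dual_left_apply (M : BanachBimodule A X) (a : A) (f : StrongDual ℂ X) (x : X) :
    M.dual.left a f x = f (M.right a x) := rfl

@[simp] theorem dual_right_apply (M : BanachBimodule A X) (a : A) (f : StrongDual ℂ X) (x : X) :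
    M.dual.right a f x = f (M.left a x) := rfl

/-- A bounded operator `D : A → X` is a derivation if `D (a b) = a D(b) + D(a) b`. -/
def IsDerivation (M : BanachBimodule A X) (D : A →L[ℂ] X) : Prop :=
  ∀ a b : A, D (a * b) = M.left a (D b) + M.right b (D a)

/-- `D : A → X` is inner if `D a = a x - x a` for some `x` in `X`. -/
def IsInner (M : BanachBimodule A X) (D : A →L[ℂ] X) : Prop :=
  ∃ x : X, ∀ a : A, D a = M.left a x - M.right a x

/-- A bounded operator `D : A → X` is hyperlocal if `a b = b c = 0` implies `a D(b) c = 0`. -/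
def IsHyperlocal (M : BanachBimodule A X) (D : A →L[ℂ] X) : Prop :=
  ∀ a b c : A, a * b = 0 → b * c = 0 → M.left a (M.right c (D b)) = 0

end BanachBimodule

/-- A Banach algebra `A` is amenable if, for every Banach `A`-bimodule `X`, every bounded
derivation from `A` to the dual bimodule `X*` is inner. -/
def IsAmenable (A : Type u) [NonUnitalNormedRing A] [NormedSpace ℂ A] [IsScalarTower ℂ A A]
    [SMulCommClass ℂ A A] [CompleteSpace A] : Prop :=
  ∀ (X : Type u) [NormedAddCommGroup X] [NormedSpace ℂ X] [CompleteSpace X]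
    (M : BanachBimodule A X) (D : A →L[ℂ] StrongDual ℂ X),
    M.dual.IsDerivation D → M.dual.IsInner D

/-! The main input is that a bounded bilinear map on a C*-algebra vanishing on pairs with zero
product is balanced: `φ (a * b) c = φ a (b * c)`. Functional calculus for self-adjoint `b` reduces
this to `B h 1 = B 1 h` on `C(K)`, which follows by cutting `h` into thin layers.

If `D` is hyperlocal and `X` essential, two uses of balancedness give `D(abc) = a D(bc) + D(ab) c -
a D(b) c`. Letting `b` run through an approximate unit, with `g` a weak* limit of `D(b)`, makes `a ↦
D(a) - a g` a derivation, and amenability makes it inner.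

Conversely, derivations are hyperlocal. On the closed span of `A X A`, which is essential, the
hypothesis gives `D(a) = a f - g a`, and the derivation rule forces `f = g`. Extending `f` to `X`
and subtracting leaves a derivation that kills `A X A`; an approximate unit shows that it is inner.
-/

open Filter Topology

/-! ### Slicing a real number into unit layers. -/

/-- Truncation of `t` to the unit interval. -/
noncomputable def unitClamp (t : ℝ) : ℝ := max 0 (min 1 t)

theorem continuous_unitClamp : Continuous unitClamp := by
  unfold unitClamp; fun_prop

theorem unitClamp_nonneg (t : ℝ) : 0 ≤ unitClamp t := le_max_left _ _

theorem unitClamp_le_one (t : ℝ) : unitClamp t ≤ 1 := by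
  simp [unitClamp]

theorem unitClamp_of_nonpos {t : ℝ} (h : t ≤ 0) : unitClamp t = 0 := by
  rw [unitClamp, min_eq_right (by linarith), max_eq_left h]

theorem unitClamp_of_one_le {t : ℝ} (h : 1 ≤ t) : unitClamp t = 1 := by
  rw [unitClamp, min_eq_left h, max_eq_right zero_le_one]

theorem unitClamp_mul_unitClamp_of_add_one_le {s t : ℝ} (h : s + 1 ≤ t) :
    unitClamp s * unitClamp t = unitClamp s := by
  rcases le_total s 0 with hs | hs
  · simp [unitClamp_of_nonpos hs]
  · rw [unitClamp_of_one_le (by linarith : 1 ≤ t), mul_one]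

theorem sum_unitClamp (n : ℕ) {t : ℝ} (h0 : 0 ≤ t) (hn : t ≤ n) :
    ∑ k ∈ Finset.range n, unitClamp (t - k) = t := by
  induction n generalizing t with
  | zero => simp at hn ⊢; linarith
  | succ n ih =>
    rw [Finset.sum_range_succ]
    rcases le_total t n with h | h
    · rw [ih h0 h, unitClamp_of_nonpos (by linarith), add_zero]
    · have : ∀ k ∈ Finset.range n, unitClamp (t - k) = 1 := by
        intro k hk
        apply unitClamp_of_one_le
        have : (k : ℝ) + 1 ≤ n := by exact_mod_cast Finset.mem_range.1 hk
        linarith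
      rw [Finset.sum_congr rfl this, unitClamp, min_eq_right (by push_cast at hn; linarith),
        max_eq_right (by linarith)]
      simp

/-! ### Orthogonality-preserving bilinear maps on `C(K)`. -/

section Orthogonal

variable {K E : Type*} [TopologicalSpace K] [CompactSpace K] [NormedAddCommGroup E]
  [NormedSpace ℝ E]

/-- A sum of terms `B (u i) (v i)` is a single value of `B`, if all the cross terms vanish. -/
theorem sum_apply_apply_of_orthogonal {F ι : Type*} [AddCommGroup F] [Module ℝ F]
    (B : F →ₗ[ℝ] F →ₗ[ℝ] E) (S : Finset ι) (u v : ι → F)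
    (h : ∀ i ∈ S, ∀ j ∈ S, i ≠ j → B (u i) (v j) = 0) :
    ∑ i ∈ S, B (u i) (v i) = B (∑ i ∈ S, u i) (∑ i ∈ S, v i) := by
  simp only [map_sum, LinearMap.sum_apply]
  rw [Finset.sum_comm]
  exact Finset.sum_congr rfl fun i hi ↦ (Finset.sum_eq_single_of_mem i hi
    fun j hj hji ↦ h i hi j hj hji.symm).symm

/-- The increments are nonnegative and telescope, so any subfamily sums to at most `s 0 ≤ 1`. -/
theorem norm_sum_sub_succ_le (s : ℕ → C(K, ℝ)) (h0 : ∀ k x, 0 ≤ s k x) (h1 : ∀ k x, s k x ≤ 1)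
    (hs : ∀ k x, s (k + 1) x ≤ s k x) {S : Finset ℕ} {n : ℕ} (hS : S ⊆ Finset.range n) :
    ‖∑ k ∈ S, (s k - s (k + 1))‖ ≤ 1 := by
  rw [ContinuousMap.norm_le _ zero_le_one]
  intro x
  have hnn : ∀ k, 0 ≤ s k x - s (k + 1) x := fun k ↦ sub_nonneg.2 (hs k x)
  simp only [ContinuousMap.sum_apply, ContinuousMap.sub_apply]
  rw [Real.norm_of_nonneg (Finset.sum_nonneg fun k _ ↦ hnn k)]
  calc _ ≤ ∑ k ∈ Finset.range n, (s k x - s (k + 1) x) :=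
        Finset.sum_le_sum_of_subset_of_nonneg hS fun k _ _ ↦ hnn k
    _ = s 0 x - s n x := Finset.sum_range_sub' (fun k ↦ s k x) n
    _ ≤ 1 := by linarith [h0 n x, h1 0 x]

/-- The point is a bound independent of `n`. Increments at distance at least two are orthogonal, so
within a residue class mod 3 each sum collapses to one value of `B` on functions of norm at most 1:
three classes, two terms each. -/
theorem norm_sum_succ_apply_sub_apply_succ_le (B : C(K, ℝ) →ₗ[ℝ] C(K, ℝ) →ₗ[ℝ] E) {C : ℝ}
    (hC0 : 0 ≤ C) (hC : ∀ f g, ‖B f g‖ ≤ C * ‖f‖ * ‖g‖)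
    (hB : ∀ f g : C(K, ℝ), f * g = 0 → B f g = 0) (s : ℕ → C(K, ℝ))
    (h0 : ∀ k x, 0 ≤ s k x) (h1 : ∀ k x, s k x ≤ 1)
    (hs : ∀ k l, k < l → s l * s k = s l) (n : ℕ) :
    ‖∑ k ∈ Finset.range n, (B (s (k + 1)) 1 - B 1 (s (k + 1)))‖ ≤ 6 * C := by
  set a : ℕ → C(K, ℝ) := fun k ↦ s k - s (k + 1) with ha
  have hmono : ∀ k x, s (k + 1) x ≤ s k x := by
    intro k x
    have := congrArg (fun f : C(K, ℝ) ↦ f x) (hs k (k + 1) k.lt_succ_self)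
    simp only [ContinuousMap.mul_apply] at this
    rw [← this]
    exact mul_le_of_le_one_left (h0 _ _) (h1 _ _)
  have hortho : ∀ k l, k + 2 ≤ l → a k * a l = 0 := by
    intro k l hkl
    simp only [ha, sub_mul, mul_sub, mul_comm (s k), mul_comm (s (k + 1))]
    rw [hs k l (by omega), hs (k + 1) l (by omega), hs k (l + 1) (by omega),
      hs (k + 1) (l + 1) (by omega)]
    simp
  have hortho' : ∀ k l, k + 2 ≤ l → a l * a k = 0 := fun k l h ↦ by rw [mul_comm, hortho k l h]
  -- `B (s (k+1)) 1 - B 1 (s (k+1))` only sees the increments of `s` next to `k`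
  have hstep : ∀ k, B (s (k + 1)) 1 - B 1 (s (k + 1)) =
      B (a (k + 1)) (a k) - B (a k) (a (k + 1)) := by
    intro k
    have e1 := hs k (k + 1) (by omega)
    have e2 := hs (k + 1) (k + 2) (by omega)
    have e3 := hs k (k + 2) (by omega)
    -- `s k` is 1 wherever `s (k + 1)` is nonzero, so it may replace 1. The diagonal term `B (s (k +
    -- 1)) (s (k + 1))` cancels in the difference.
    have t1 : B (s (k + 1)) (1 - s k) = 0 := hB _ _ (by rw [mul_sub, e1, mul_one, sub_self])
    have t2 : B (1 - s k) (s (k + 1)) = 0 := 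
      hB _ _ (by rw [sub_mul, mul_comm (s k), e1, one_mul, sub_self])
    have t3 : B (s (k + 2)) (s k - s (k + 1)) = 0 := hB _ _ (by rw [mul_sub, e2, e3, sub_self])
    have t4 : B (s k - s (k + 1)) (s (k + 2)) = 0 :=
      hB _ _ (by rw [sub_mul, mul_comm (s k), e3, mul_comm (s (k + 1)), e2, sub_self])
    simp only [ha, map_sub, LinearMap.sub_apply, add_assoc, one_add_one_eq_two] at *
    rw [sub_eq_zero] at t1 t2 t3 t4
    rw [t1, t2, t3, t4]
    abel
  have hsplit : ∀ f : ℕ → E, ∑ k ∈ Finset.range n, f k =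
      ∑ r ∈ Finset.range 3, ∑ k ∈ Finset.range n with k % 3 = r, f k := fun f ↦
    (Finset.sum_fiberwise_of_maps_to
      (fun k _ ↦ Finset.mem_range.2 (Nat.mod_lt k (by norm_num))) f).symm
  have hn0 : ∀ r, ‖∑ k ∈ Finset.range n with k % 3 = r, a k‖ ≤ 1 := fun r ↦
    norm_sum_sub_succ_le s h0 h1 hmono (Finset.filter_subset _ _)
  have hn1 : ∀ r, ‖∑ k ∈ Finset.range n with k % 3 = r, a (k + 1)‖ ≤ 1 := fun r ↦
    norm_sum_sub_succ_le (fun k ↦ s (k + 1)) (fun k ↦ h0 _) (fun k ↦ h1 _) (fun k ↦ hmono _)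
      (Finset.filter_subset _ _)
  have hbd : ∀ f g : C(K, ℝ), ‖f‖ ≤ 1 → ‖g‖ ≤ 1 → ‖B f g‖ ≤ C := fun f g hf hg ↦ by
    calc _ ≤ C * ‖f‖ * ‖g‖ := hC f g
      _ ≤ C * 1 * 1 := by gcongr
      _ = C := by ring
  have hblock : ∀ r, ‖∑ k ∈ Finset.range n with k % 3 = r,
      (B (a (k + 1)) (a k) - B (a k) (a (k + 1)))‖ ≤ 2 * C := by
    intro r
    rw [Finset.sum_sub_distrib, sum_apply_apply_of_orthogonal B _ (fun k ↦ a (k + 1)) a,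
      sum_apply_apply_of_orthogonal B _ a (fun k ↦ a (k + 1))]
    · calc _ ≤ _ := norm_sub_le _ _
        _ ≤ C + C := add_le_add (hbd _ _ (hn1 r) (hn0 r)) (hbd _ _ (hn0 r) (hn1 r))
        _ = 2 * C := by ring
    · intro i hi j hj hij
      simp only [Finset.mem_filter] at hi hj
      rcases lt_or_gt_of_ne hij with h | h
      · exact hB _ _ (hortho _ _ (by omega))
      · exact hB _ _ (hortho' _ _ (by omega))
    · intro i hi j hj hij
      simp only [Finset.mem_filter] at hi hj
      rcases lt_or_gt_of_ne hij with h | h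
      · exact hB _ _ (hortho _ _ (by omega))
      · exact hB _ _ (hortho' _ _ (by omega))
  simp only [hstep]
  rw [hsplit]
  calc _ ≤ ∑ r ∈ Finset.range 3, (2 * C) := norm_sum_le_of_le _ fun r _ ↦ hblock r
    _ = 6 * C := by simp; ring

/-- A bounded bilinear map on `C(K)` that vanishes on pairs of functions with zero product
satisfies `B h 1 = B 1 h`. -/
theorem apply_one_eq_one_apply_of_orthogonal (B : C(K, ℝ) →ₗ[ℝ] C(K, ℝ) →ₗ[ℝ] E) {C : ℝ}
    (hC : ∀ f g, ‖B f g‖ ≤ C * ‖f‖ * ‖g‖)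
    (hB : ∀ f g : C(K, ℝ), f * g = 0 → B f g = 0) (h : C(K, ℝ)) : B h 1 = B 1 h := by
  wlog hC0 : 0 ≤ C generalizing C
  · refine this (C := |C|) (fun f g ↦ (hC f g).trans ?_) (abs_nonneg C)
    gcongr
    exact le_abs_self C
  set m := ‖h‖ with hm
  have key : ∀ n : ℕ, 0 < n → ‖B h 1 - B 1 h‖ ≤ (2 * m + 1) / n * (6 * C) := by
    intro n hn
    -- Layer height: `h + m` takes values in `[0, 2m]`, and the extra 1 keeps `ε` positive when `h =
    -- 0`. The shift by 1 in `s` gives the first layer `s 1` a predecessor `s 0`.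
    set ε := (2 * m + 1) / n with hε
    have hεpos : 0 < ε := by positivity
    let s : ℕ → C(K, ℝ) := fun k ↦
      ⟨fun x ↦ unitClamp ((h x + m) / ε + 1 - k),
        continuous_unitClamp.comp (by fun_prop)⟩
    have hsum : h = ε • ∑ k ∈ Finset.range n, s (k + 1) - m • (1 : C(K, ℝ)) := by
      ext x
      have hx := abs_le.1 (h.norm_coe_le_norm x)
      have h2 : (h x + m) / ε ≤ n := by
        rw [div_le_iff₀ hεpos, hε, mul_div_cancel₀ _ (by positivity)]
        linarith
      have h3 : 0 ≤ (h x + m) / ε := div_nonneg (by linarith) hεpos.le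
      have := sum_unitClamp n h3 h2
      simp only [ContinuousMap.sub_apply, ContinuousMap.smul_apply, ContinuousMap.sum_apply,
        ContinuousMap.coe_mk, s, ContinuousMap.one_apply, smul_eq_mul, mul_one]
      have e : ∀ k : ℕ, (h x + m) / ε + 1 - ((k + 1 : ℕ) : ℝ) = (h x + m) / ε - k := by
        intro k; push_cast; ring
      simp only [e, this]
      field_simp
      ring
    have hd : B h 1 - B 1 h =
        ε • ∑ k ∈ Finset.range n, (B (s (k + 1)) 1 - B 1 (s (k + 1))) := by
      rw [hsum]
      simp only [map_sub, map_smul, map_sum, LinearMap.sub_apply, LinearMap.smul_apply,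
        LinearMap.sum_apply, Finset.sum_sub_distrib, smul_sub]
      abel
    rw [hd, norm_smul, Real.norm_of_nonneg hεpos.le]
    refine mul_le_mul_of_nonneg_left (norm_sum_succ_apply_sub_apply_succ_le B hC0 hC hB s
      (fun k x ↦ unitClamp_nonneg _) (fun k x ↦ unitClamp_le_one _) (fun k l hkl ↦ ?_) n) hεpos.le
    ext x
    refine unitClamp_mul_unitClamp_of_add_one_le ?_
    have : (k : ℝ) + 1 ≤ l := by exact_mod_cast hkl
    linarith
  have hlim : Tendsto (fun n : ℕ ↦ (2 * m + 1) / n * (6 * C)) atTop (𝓝 0) := by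
    simpa using (tendsto_const_div_atTop_nhds_zero_nat (2 * m + 1)).mul_const (6 * C)
  refine sub_eq_zero.1 (norm_le_zero_iff.1 (ge_of_tendsto hlim ?_))
  filter_upwards [eventually_gt_atTop 0] with n hn using key n hn

end Orthogonal

/-! ### Zero-product-preserving bilinear maps on C*-algebras. -/

section ZeroProduct

variable {A E : Type*} [NonUnitalCStarAlgebra A] [NormedAddCommGroup E] [NormedSpace ℂ E]

theorem Unitization.inr_snd_inr_mul (a : A) (u : Unitization ℂ A) :
    (((a : Unitization ℂ A) * u).snd : Unitization ℂ A) = a * u := by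
  ext <;> simp

theorem Unitization.inr_snd_mul_inr (a : A) (u : Unitization ℂ A) :
    ((u * (a : Unitization ℂ A)).snd : Unitization ℂ A) = u * a := by
  ext <;> simp

theorem Unitization.norm_snd_inr_mul_le (a : A) (u : Unitization ℂ A) :
    ‖((a : Unitization ℂ A) * u).snd‖ ≤ ‖a‖ * ‖u‖ := by
  rw [← Unitization.norm_inr (𝕜 := ℂ), Unitization.inr_snd_inr_mul,
    ← Unitization.norm_inr (𝕜 := ℂ) (a := a)]
  exact norm_mul_le _ _

theorem Unitization.norm_snd_mul_inr_le (a : A) (u : Unitization ℂ A) :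
    ‖(u * (a : Unitization ℂ A)).snd‖ ≤ ‖u‖ * ‖a‖ := by
  rw [← Unitization.norm_inr (𝕜 := ℂ), Unitization.inr_snd_mul_inr,
    ← Unitization.norm_inr (𝕜 := ℂ) (a := a)]
  exact norm_mul_le _ _

/-- The functional calculus `Φ` of `b` lives in the unitization, but `a Φ(f)` and `Φ(g) c` lie in
the ideal `A`, and their product is zero when `f g = 0`. The `C(K)` result then applies to the
identity function. -/
theorem apply_mul_eq_apply_mul_of_isSelfAdjoint (φ : A →L[ℂ] A →L[ℂ] E)
    (hφ : ∀ a b : A, a * b = 0 → φ a b = 0) (a b c : A) (hb : IsSelfAdjoint b) :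
    φ (a * b) c = φ a (b * c) := by
  have hb' : IsSelfAdjoint (b : Unitization ℂ A) := hb.inr ℂ
  let _ : NormedSpace ℝ E := NormedSpace.restrictScalars ℝ ℂ E
  let Φ := cfcHom (R := ℝ) hb'
  let B : C(spectrum ℝ (b : Unitization ℂ A), ℝ) →ₗ[ℝ]
      C(spectrum ℝ (b : Unitization ℂ A), ℝ) →ₗ[ℝ] E :=
    LinearMap.mk₂ ℝ (fun f g ↦ φ ((a : Unitization ℂ A) * Φ f).snd (Φ g * (c : Unitization ℂ A)).snd)
      (fun f g k ↦ by rw [map_add, mul_add, Unitization.snd_add, map_add]; rfl)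
      (fun r f k ↦ by
        rw [map_smul, mul_smul_comm, Unitization.snd_smul, ← Complex.coe_smul, map_smul]; rfl)
      (fun f g k ↦ by rw [map_add, add_mul, Unitization.snd_add, map_add])
      (fun r f k ↦ by
        rw [map_smul, smul_mul_assoc, Unitization.snd_smul, ← Complex.coe_smul, map_smul]; rfl)
  have hBa : ∀ f g, B f g =
      φ ((a : Unitization ℂ A) * Φ f).snd (Φ g * (c : Unitization ℂ A)).snd := fun f g ↦ rfl
  have := apply_one_eq_one_apply_of_orthogonal B (C := ‖φ‖ * ‖a‖ * ‖c‖) (fun f g ↦ by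
      rw [hBa]
      calc _ ≤ ‖φ‖ * _ * _ := φ.le_opNorm₂ _ _
        _ ≤ ‖φ‖ * (‖a‖ * ‖Φ f‖) * (‖Φ g‖ * ‖c‖) := by
          gcongr
          · exact Unitization.norm_snd_inr_mul_le _ _
          · exact Unitization.norm_snd_mul_inr_le _ _
        _ = ‖φ‖ * ‖a‖ * ‖c‖ * ‖f‖ * ‖g‖ := by
          rw [norm_cfcHom (𝕜 := ℝ) _ f hb', norm_cfcHom (𝕜 := ℝ) _ g hb']; ring)
    (fun f g hfg ↦ hφ _ _ <| Unitization.inr_injective (R := ℂ) <| by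
      rw [Unitization.inr_mul, Unitization.inr_snd_inr_mul, Unitization.inr_snd_mul_inr,
        mul_assoc, ← mul_assoc (Φ f), ← map_mul, hfg]
      simp)
    ((ContinuousMap.id ℝ).restrict _)
  simp only [hBa, map_one, mul_one, one_mul] at this
  have hid : Φ ((ContinuousMap.id ℝ).restrict _) = b := cfcHom_id hb'
  rw [hid] at this
  simpa using this

/-- A bounded bilinear map on a C⋆-algebra that vanishes on pairs with zero product is balanced. -/
theorem apply_mul_eq_apply_mul_of_zero_product (φ : A →L[ℂ] A →L[ℂ] E)
    (hφ : ∀ a b : A, a * b = 0 → φ a b = 0) (a b c : A) : φ (a * b) c = φ a (b * c) := by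
  rw [← realPart_add_I_smul_imaginaryPart b]
  simp only [mul_add, add_mul, map_add, mul_smul_comm, smul_mul_assoc, map_smul,
    add_apply, smul_apply]
  rw [apply_mul_eq_apply_mul_of_isSelfAdjoint φ hφ a _ c (realPart b).2,
    apply_mul_eq_apply_mul_of_isSelfAdjoint φ hφ a _ c (imaginaryPart b).2]

end ZeroProduct

/-! ### Approximate units and weak* limits. -/

theorem exists_ultrafilter_approximateUnit (A : Type*) [NonUnitalCStarAlgebra A] :
    ∃ U : Ultrafilter A, (∀ a : A, Tendsto (· * a) U (𝓝 a)) ∧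
      (∀ a : A, Tendsto (a * ·) U (𝓝 a)) ∧ ∀ᶠ e in (U : Filter A), ‖e‖ ≤ 1 := by
  let _ := CStarAlgebra.spectralOrder A
  have := CStarAlgebra.spectralOrderedRing A
  have h := CStarAlgebra.increasingApproximateUnit A
  have hle := Ultrafilter.of_le (CStarAlgebra.approximateUnit A)
  exact ⟨Ultrafilter.of (CStarAlgebra.approximateUnit A),
    fun a ↦ (h.tendsto_mul_right a).mono_left hle, fun a ↦ (h.tendsto_mul_left a).mono_left hle,
    h.eventually_norm.filter_mono hle⟩

/-- A bounded family of functionals converges pointwise along every ultrafilter. -/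
theorem StrongDual.exists_forall_tendsto_apply {ι X : Type*} [NormedAddCommGroup X]
    [NormedSpace ℂ X] (U : Ultrafilter ι) (F : ι → StrongDual ℂ X) {C : ℝ}
    (hF : ∀ᶠ i in (U : Filter ι), ‖F i‖ ≤ C) :
    ∃ g : StrongDual ℂ X, ∀ x, Tendsto (fun i ↦ F i x) U (𝓝 (g x)) := by
  obtain ⟨g, -, hg⟩ := (WeakDual.isCompact_closedBall (𝕜 := ℂ) (0 : StrongDual ℂ X)
    C).ultrafilter_le_nhds (U.map fun i ↦ StrongDual.toWeakDual (F i)) (by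
      rw [le_principal_iff]
      exact Filter.mem_map.2 (hF.mono fun i hi ↦ by simpa using hi))
  refine ⟨WeakDual.toStrongDual g, fun x ↦ ?_⟩
  have h : Tendsto (fun i ↦ StrongDual.toWeakDual (F i)) U (𝓝 g) := hg
  exact ((WeakBilin.eval_continuous _ x).tendsto g).comp h

theorem exists_forall_tendsto_apply_of_eventually_norm_le_one {A X : Type*}
    [NonUnitalNormedRing A] [NormedSpace ℂ A] [NormedAddCommGroup X] [NormedSpace ℂ X]
    {U : Ultrafilter A} (hU : ∀ᶠ e in (U : Filter A), ‖e‖ ≤ 1) (D : A →L[ℂ] StrongDual ℂ X) :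
    ∃ g : StrongDual ℂ X, ∀ x, Tendsto (fun e ↦ D e x) U (𝓝 (g x)) :=
  StrongDual.exists_forall_tendsto_apply U D (C := ‖D‖) <| hU.mono fun e he ↦
    (D.le_opNorm e).trans (mul_le_of_le_one_right (norm_nonneg _) he)

theorem ContinuousLinearMap.tendsto_apply_apply {A X : Type*} [NormedAddCommGroup A]
    [NormedSpace ℂ A] [NormedAddCommGroup X] [NormedSpace ℂ X] (D : A →L[ℂ] StrongDual ℂ X)
    {ι : Type*} {l : Filter ι} {u : ι → A} {a : A} (h : Tendsto u l (𝓝 a)) (x : X) :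
    Tendsto (fun i ↦ D (u i) x) l (𝓝 (D a x)) :=
  (((ContinuousLinearMap.apply ℂ ℂ x).comp D).continuous.tendsto a).comp h

/-! ### Derivations and essential bimodules. -/

namespace BanachBimodule

section General

variable {A X : Type*} [NonUnitalNormedRing A] [NormedSpace ℂ A]
  [NormedAddCommGroup X] [NormedSpace ℂ X] {M : BanachBimodule A X}

theorem IsEssential.eq_zero_of_forall_left (hM : M.IsEssential) {f : StrongDual ℂ X}
    (h : ∀ a x, f (M.left a x) = 0) : f = 0 := by
  have hle : Submodule.span ℂ {y : X | ∃ (a : A) (x : X), y = M.left a x} ≤ f.ker := by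
    rw [Submodule.span_le]
    rintro _ ⟨a, x, rfl⟩
    exact h a x
  exact DFunLike.coe_injective
    (f.continuous.ext_on hM.1 (g := 0) continuous_zero fun y hy ↦ hle hy)

theorem IsEssential.eq_zero_of_forall_right (hM : M.IsEssential) {f : StrongDual ℂ X}
    (h : ∀ a x, f (M.right a x) = 0) : f = 0 := by
  have hle : Submodule.span ℂ {y : X | ∃ (a : A) (x : X), y = M.right a x} ≤ f.ker := by
    rw [Submodule.span_le]
    rintro _ ⟨a, x, rfl⟩
    exact h a x
  exact DFunLike.coe_injective
    (f.continuous.ext_on hM.2 (g := 0) continuous_zero fun y hy ↦ hle hy)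

theorem IsEssential.eq_zero_of_forall_left_right (hM : M.IsEssential) {f : StrongDual ℂ X}
    (h : ∀ a b x, f (M.left a (M.right b x)) = 0) : f = 0 :=
  hM.eq_zero_of_forall_left fun a x ↦ congrArg (· x) <|
    hM.eq_zero_of_forall_right (f := f.comp (M.left a)) fun b x ↦ h a b x

theorem IsDerivation.isHyperlocal {D : A →L[ℂ] X} (hD : M.IsDerivation D) :
    M.IsHyperlocal D := by
  intro a b c hab hbc
  have h := hD a b
  rw [hab, map_zero] at h
  have h2 : M.right c (M.left a (D b)) = M.right c (-M.right b (D a)) := by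
    rw [eq_neg_of_add_eq_zero_left h.symm]
  rw [M.left_right, h2, map_neg, ← M.right_mul, hbc]
  simp

/-- In the essential case, a derivation of the form `a ↦ a f - g a` is inner. -/
theorem IsDerivation.isInner_of_isEssential (hM : M.IsEssential) {D : A →L[ℂ] StrongDual ℂ X}
    (hD : M.dual.IsDerivation D) {f g : StrongDual ℂ X}
    (h : ∀ a, D a = M.dual.left a f - M.dual.right a g) : M.dual.IsInner D := by
  -- Comparing the two expressions for `D (a * b)` gives `a (f - g) b = 0`.
  have hfg : f - g = 0 := hM.eq_zero_of_forall_left_right fun b a x ↦ by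
    have := congrArg (· x) (hD a b)
    simp only [h, add_apply, sub_apply, dual_left_apply, dual_right_apply,
      M.left_mul, M.right_mul, map_sub, M.left_right] at this ⊢
    linear_combination -this
  rw [sub_eq_zero] at hfg
  exact ⟨f, fun a ↦ by rw [h a, hfg]⟩

end General

/-! ### Hyperlocal operators and derivations on C*-algebras. -/

section CStar

variable {A X : Type*} [NonUnitalCStarAlgebra A] [NormedAddCommGroup X] [NormedSpace ℂ X]
  {M : BanachBimodule A X}

/-- Balancedness is used twice. For fixed `a b = 0`, the form `(c, d) ↦ a D(bc) d` kills zero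
products. The resulting identity says that a second form, in `(a, b)`, kills zero products too. -/
theorem IsHyperlocal.apply_mul_mul_mul_sub {D : A →L[ℂ] StrongDual ℂ X}
    (hD : M.dual.IsHyperlocal D) (a b c c' d a' : A) (x : X) :
    D (b * (c * c')) (M.left d (M.right (a * a') x)) -
        D (b * c) (M.left c' (M.left d (M.right (a * a') x))) =
      D (a' * b * (c * c')) (M.left d (M.right a x)) -
        D (a' * b * c) (M.left c' (M.left d (M.right a x))) := by
  let mulRight (p : A) : A →L[ℂ] A := (ContinuousLinearMap.mul ℂ A).flip p
  let φ (b : A) (y : X) : A →L[ℂ] A →L[ℂ] ℂ :=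
    (ContinuousLinearMap.id ℂ (StrongDual ℂ X)).bilinearComp
      (D.comp (ContinuousLinearMap.mul ℂ A b)) (M.left.flip y)
  have hφ (a b : A) (hab : a * b = 0) :
      D (b * (c * c')) (M.left d (M.right a x)) = D (b * c) (M.left (c' * d) (M.right a x)) := by
    refine apply_mul_eq_apply_mul_of_zero_product (φ b (M.right a x)) (fun c d hcd ↦ ?_) c c' d
    have := hD a (b * c) d (by rw [← mul_assoc, hab, zero_mul]) (by rw [mul_assoc, hcd, mul_zero])
    exact congrArg (· x) this
  let ψ₁ : A →L[ℂ] A →L[ℂ] ℂ :=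
    ((ContinuousLinearMap.id ℂ (StrongDual ℂ X)).bilinearComp (D.comp (mulRight (c * c')))
      ((M.left d).comp (M.right.flip x))).flip
  let ψ₂ : A →L[ℂ] A →L[ℂ] ℂ :=
    ((ContinuousLinearMap.id ℂ (StrongDual ℂ X)).bilinearComp (D.comp (mulRight c))
      ((M.left (c' * d)).comp (M.right.flip x))).flip
  have hψ := apply_mul_eq_apply_mul_of_zero_product (ψ₁ - ψ₂)
    (fun a b hab ↦ sub_eq_zero.2 (hφ a b hab)) a a' b
  simp only [← M.left_mul]
  exact hψ

/-- A hyperlocal operator into the dual of an essential bimodule satisfies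
`D(abc) = a D(bc) + D(ab) c - a D(b) c`. -/
theorem IsHyperlocal.map_mul_mul {D : A →L[ℂ] StrongDual ℂ X} (hM : M.IsEssential)
    (hD : M.dual.IsHyperlocal D) (a b c : A) :
    D (a * b * c) = M.dual.left a (D (b * c)) + M.dual.right c (D (a * b)) -
      M.dual.left a (M.dual.right c (D b)) := by
  let G (b : A) : StrongDual ℂ X := D (a * b * c) - M.dual.right c (D (a * b)) -
    (M.dual.left a (D (b * c)) - M.dual.left a (M.dual.right c (D b)))
  have hG : Continuous G := by fun_prop
  -- The balanced identity needs a product `b * e` in the middle; `e` is removed by an approximate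
  -- unit, the outer factors by essentiality.
  have hG0 : ∀ e, G (b * e) = 0 := by
    intro e
    refine hM.eq_zero_of_forall_left_right fun d a₁ x ↦ ?_
    have := hD.apply_mul_mul_mul_sub a₁ b e c d a x
    simp only [G, sub_apply, dual_left_apply, dual_right_apply, M.right_mul, M.left_right,
      mul_assoc] at this ⊢
    linear_combination -this
  obtain ⟨U, -, hU, -⟩ := exists_ultrafilter_approximateUnit A
  have hlim := (hG.tendsto b).comp (hU b)
  simp only [Function.comp_def, hG0] at hlim
  have h0 := tendsto_nhds_unique hlim tendsto_const_nhds
  rw [← sub_eq_zero, ← h0]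
  simp only [G]
  abel

/-- With an approximate unit in the middle, the triple identity becomes `D(ac) = a D(c) + D(a) c - a
g c`, where `g` is the weak* limit of `D(e)`. -/
theorem IsHyperlocal.exists_isDerivation_sub {D : A →L[ℂ] StrongDual ℂ X} (hM : M.IsEssential)
    (hD : M.dual.IsHyperlocal D) :
    ∃ g : StrongDual ℂ X, M.dual.IsDerivation (D - M.dual.left.flip g) := by
  obtain ⟨U, hU₁, hU₂, hU⟩ := exists_ultrafilter_approximateUnit A
  obtain ⟨g, hg⟩ := exists_forall_tendsto_apply_of_eventually_norm_le_one hU D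
  refine ⟨g, fun a c ↦ ?_⟩
  ext x
  have h1 : Tendsto (fun e ↦ D (a * e * c) x) U (𝓝 (D (a * c) x)) :=
    D.tendsto_apply_apply ((hU₂ a).mul_const c) x
  have h2 := D.tendsto_apply_apply (hU₁ c) (M.right a x)
  have h3 := D.tendsto_apply_apply (hU₂ a) (M.left c x)
  have h4 := hg (M.left c (M.right a x))
  have h5 := tendsto_nhds_unique h1 (((h2.add h3).sub h4).congr fun e ↦ by
    rw [hD.map_mul_mul hM]; rfl)
  simp only [sub_apply, add_apply, ContinuousLinearMap.flip_apply, dual_left_apply,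
    dual_right_apply, M.right_mul, M.left_right, map_sub] at h5 ⊢
  linear_combination h5

/-- A derivation into a dual bimodule that is killed by two-sided multiplication is inner. -/
theorem IsDerivation.isInner_of_forall_left_right_eq_zero {D : A →L[ℂ] StrongDual ℂ X}
    (hD : M.dual.IsDerivation D) (h0 : ∀ a b c x, D a (M.left b (M.right c x)) = 0) :
    M.dual.IsInner D := by
  obtain ⟨U, hU₁, hU₂, hU⟩ := exists_ultrafilter_approximateUnit A
  obtain ⟨g, hg⟩ := exists_forall_tendsto_apply_of_eventually_norm_le_one hU D
  -- It will turn out that `D(a) = a g + g a`. This is `a h - h a` if `h` is `g` on `X A` and `-g`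
  -- on `A X`; the limit of `e g - g e` is such an `h`, as `g` kills `A X A`.
  obtain ⟨h, hh⟩ := exists_forall_tendsto_apply_of_eventually_norm_le_one hU
    (M.dual.left.flip g - M.dual.right.flip g)
  have hg0 : ∀ b c x, g (M.left b (M.right c x)) = 0 := fun b c x ↦
    tendsto_nhds_unique (hg _) (by simp only [h0]; exact tendsto_const_nhds)
  have hl : ∀ a x, h (M.right a x) = g (M.right a x) := by
    intro a x
    refine tendsto_nhds_unique (hh _) ?_
    have : Tendsto (fun e ↦ g (M.right.flip x (a * e))) U (𝓝 (g (M.right.flip x a))) :=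
      ((g.comp (M.right.flip x)).continuous.tendsto a).comp (hU₂ a)
    refine this.congr fun e ↦ ?_
    simp [hg0, M.right_mul]
  have hr : ∀ a x, h (M.left a x) = -g (M.left a x) := by
    intro a x
    refine tendsto_nhds_unique (hh _) ?_
    have : Tendsto (fun e ↦ -g (M.left.flip x (e * a))) U (𝓝 (-g (M.left.flip x a))) :=
      (((g.comp (M.left.flip x)).continuous.tendsto a).comp (hU₁ a)).neg
    refine this.congr fun e ↦ ?_
    simp [hg0, M.left_mul, ← M.left_right]
  -- on products, `D` is the sum of its left and right limits along the approximate unit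
  have hlim : ∀ b c x, Tendsto (fun e ↦ D (b * c) (M.left e x) + D (b * c) (M.right e x)) U
      (𝓝 (D (b * c) x)) := by
    intro b c x
    have h1 : Tendsto (fun e ↦ D b (M.left.flip x (c * e))) U (𝓝 (D b (M.left.flip x c))) :=
      (((D b).comp (M.left.flip x)).continuous.tendsto c).comp (hU₂ c)
    have h2 : Tendsto (fun e ↦ D c (M.right.flip x (e * b))) U (𝓝 (D c (M.right.flip x b))) :=
      (((D c).comp (M.right.flip x)).continuous.tendsto b).comp (hU₁ b)
    have h3 := h1.add h2
    have e1 : D b (M.left.flip x c) + D c (M.right.flip x b) = D (b * c) x := by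
      rw [hD b c]; simp [add_comm]
    rw [e1] at h3
    refine h3.congr fun e ↦ ?_
    rw [hD b c]
    simp [h0, ← M.left_right, M.left_mul, M.right_mul]
  let E : A →L[ℂ] StrongDual ℂ X := D - (M.dual.left.flip g + M.dual.right.flip g)
  have hE : ∀ b c, E (b * c) = 0 := by
    intro b c
    ext x
    have h1 := D.tendsto_apply_apply (hU₂ (b * c)) x
    have h2 := D.tendsto_apply_apply (hU₁ (b * c)) x
    -- For `a = b * c`, the limit of `D(a e) + D(e a)` reads `2 D(a) = a g + g a + D(a)`.
    have h3 := ((hg (M.right (b * c) x)).add (hg (M.left (b * c) x))).add (hlim b c x)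
    have h4 := tendsto_nhds_unique (h1.add h2) (h3.congr fun e ↦ by
      rw [hD (b * c) e, hD e (b * c)]
      simp only [add_apply, dual_left_apply, dual_right_apply]
      ring)
    simp only [E, sub_apply, add_apply, ContinuousLinearMap.flip_apply, dual_left_apply,
      dual_right_apply, zero_apply]
    linear_combination h4
  have hE' : ∀ a, E a = 0 := fun a ↦ by
    have := (E.continuous.tendsto a).comp (hU₂ a)
    simp only [Function.comp_def, hE] at this
    exact tendsto_nhds_unique this tendsto_const_nhds
  refine ⟨h, fun a ↦ ?_⟩
  ext x
  have := congrArg (· x) (hE' a)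
  simp only [E, sub_apply, add_apply, ContinuousLinearMap.flip_apply, dual_left_apply,
    dual_right_apply, zero_apply, hl, hr] at this ⊢
  linear_combination this

end CStar

end BanachBimodule

/-! ### Reduction to the essential part. -/

namespace BanachBimodule

section Restrict

variable {A X : Type*} [NonUnitalNormedRing A] [NormedSpace ℂ A]
  [NormedAddCommGroup X] [NormedSpace ℂ X]

/-- The restriction of a bounded bilinear action to an invariant subspace. -/
noncomputable def restrictAction (T : A →L[ℂ] X →L[ℂ] X) (p : Submodule ℂ X)
    (h : ∀ a, ∀ x ∈ p, T a x ∈ p) : A →L[ℂ] p →L[ℂ] p :=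
  LinearMap.mkContinuous₂
    (LinearMap.mk₂ ℂ (fun (a : A) (x : p) ↦ (⟨T a x, h a x x.2⟩ : p))
      (fun a b x ↦ by ext; simp) (fun r a x ↦ by ext; simp)
      (fun a x y ↦ by ext; simp) (fun r a x ↦ by ext; simp))
    ‖T‖ (fun a x ↦ T.le_opNorm₂ a x)

@[simp] theorem coe_restrictAction (T : A →L[ℂ] X →L[ℂ] X) (p : Submodule ℂ X)
    (h : ∀ a, ∀ x ∈ p, T a x ∈ p) (a : A) (x : p) : (restrictAction T p h a x : X) = T a x := rfl

/-- The restriction of a bimodule to an invariant subspace. -/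
noncomputable def restrict (M : BanachBimodule A X) (p : Submodule ℂ X)
    (hl : ∀ a, ∀ x ∈ p, M.left a x ∈ p) (hr : ∀ a, ∀ x ∈ p, M.right a x ∈ p) :
    BanachBimodule A p where
  left := restrictAction M.left p hl
  right := restrictAction M.right p hr
  left_mul a b x := by ext; simp [M.left_mul]
  right_mul a b x := by ext; simp [M.right_mul]
  left_right a b x := by ext; simp [M.left_right]

@[simp] theorem coe_restrict_left (M : BanachBimodule A X) (p : Submodule ℂ X)
    (hl : ∀ a, ∀ x ∈ p, M.left a x ∈ p) (hr : ∀ a, ∀ x ∈ p, M.right a x ∈ p) (a : A) (x : p) :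
    ((M.restrict p hl hr).left a x : X) = M.left a x := rfl

@[simp] theorem coe_restrict_right (M : BanachBimodule A X) (p : Submodule ℂ X)
    (hl : ∀ a, ∀ x ∈ p, M.left a x ∈ p) (hr : ∀ a, ∀ x ∈ p, M.right a x ∈ p) (a : A) (x : p) :
    ((M.restrict p hl hr).right a x : X) = M.right a x := rfl

/-- The closed linear span of the products `a x b`. -/
def essentialPart (M : BanachBimodule A X) : Submodule ℂ X :=
  (Submodule.span ℂ {y : X | ∃ (a b : A) (x : X), y = M.left a (M.right b x)}).topologicalClosure

theorem left_right_mem_essentialPart (M : BanachBimodule A X) (a b : A) (x : X) :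
    M.left a (M.right b x) ∈ M.essentialPart :=
  Submodule.le_topologicalClosure _ (Submodule.subset_span ⟨a, b, x, rfl⟩)

theorem essentialPart_le (M : BanachBimodule A X) {p : Submodule ℂ X} (hp : IsClosed (p : Set X))
    (h : ∀ a b x, M.left a (M.right b x) ∈ p) : M.essentialPart ≤ p := by
  refine Submodule.topologicalClosure_minimal _ (Submodule.span_le.2 ?_) hp
  rintro _ ⟨a, b, x, rfl⟩
  exact h a b x

theorem isClosed_essentialPart (M : BanachBimodule A X) : IsClosed (M.essentialPart : Set X) :=
  Submodule.isClosed_topologicalClosure _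

theorem left_mem_essentialPart (M : BanachBimodule A X) (a : A) :
    ∀ x ∈ M.essentialPart, M.left a x ∈ M.essentialPart :=
  M.essentialPart_le (p := M.essentialPart.comap (M.left a).toLinearMap)
    (M.isClosed_essentialPart.preimage (M.left a).continuous) fun b c x ↦ by
      change M.left a (M.left b (M.right c x)) ∈ M.essentialPart
      rw [← M.left_mul]
      exact M.left_right_mem_essentialPart _ _ _

theorem right_mem_essentialPart (M : BanachBimodule A X) (a : A) :
    ∀ x ∈ M.essentialPart, M.right a x ∈ M.essentialPart :=
  M.essentialPart_le (p := M.essentialPart.comap (M.right a).toLinearMap)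
    (M.isClosed_essentialPart.preimage (M.right a).continuous) fun b c x ↦ by
      change M.right a (M.left b (M.right c x)) ∈ M.essentialPart
      rw [← M.left_right, ← M.right_mul]
      exact M.left_right_mem_essentialPart _ _ _

/-- A subspace of the essential part is dense if its closure contains all products `a x b`. -/
theorem dense_of_forall_left_right_mem_closure (M : BanachBimodule A X)
    (q : Submodule ℂ M.essentialPart)
    (h : ∀ a b x, M.left a (M.right b x) ∈ closure (Subtype.val '' (q : Set M.essentialPart))) :
    Dense (q : Set M.essentialPart) := by
  intro y
  rw [Topology.IsInducing.subtypeVal.closure_eq_preimage_closure_image]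
  exact M.essentialPart_le
    (p := (q.map M.essentialPart.subtype).topologicalClosure)
    (Submodule.isClosed_topologicalClosure _) h y.2

end Restrict

section CStar

variable {A X : Type*} [NonUnitalCStarAlgebra A] [NormedAddCommGroup X] [NormedSpace ℂ X]

/-- The essential part of a bimodule, as a bimodule. -/
noncomputable abbrev essentialRestrict (M : BanachBimodule A X) :
    BanachBimodule A M.essentialPart :=
  M.restrict M.essentialPart M.left_mem_essentialPart M.right_mem_essentialPart

/-- Each `a x b` is the limit of `e (a x b)` and of `(a x b) e`, with `a x b` already in the
essential part. -/
theorem isEssential_essentialRestrict (M : BanachBimodule A X) :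
    M.essentialRestrict.IsEssential := by
  obtain ⟨U, hU₁, hU₂, -⟩ := exists_ultrafilter_approximateUnit A
  constructor
  · refine M.dense_of_forall_left_right_mem_closure _ fun a b x ↦ ?_
    have h : Tendsto (fun e ↦ M.left.flip (M.right b x) (e * a)) U
        (𝓝 (M.left.flip (M.right b x) a)) :=
      ((M.left.flip (M.right b x)).continuous.tendsto a).comp (hU₁ a)
    refine mem_closure_of_tendsto h (Eventually.of_forall fun e ↦
      ⟨M.essentialRestrict.left e ⟨_, M.left_right_mem_essentialPart a b x⟩,
        Submodule.subset_span ⟨_, _, rfl⟩, ?_⟩)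
    simp [M.left_mul]
  · refine M.dense_of_forall_left_right_mem_closure _ fun a b x ↦ ?_
    have h : Tendsto (fun e ↦ M.left a (M.right.flip x (b * e))) U
        (𝓝 (M.left a (M.right.flip x b))) :=
      (((M.left a).comp (M.right.flip x)).continuous.tendsto b).comp (hU₂ b)
    refine mem_closure_of_tendsto h (Eventually.of_forall fun e ↦
      ⟨M.essentialRestrict.right e ⟨_, M.left_right_mem_essentialPart a b x⟩,
        Submodule.subset_span ⟨_, _, rfl⟩, ?_⟩)
    simp [M.left_right, M.right_mul]

/-- A derivation into a dual bimodule is inner if its restriction to the essential part is. -/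
theorem IsDerivation.isInner_of_essentialRestrict {M : BanachBimodule A X}
    {D : A →L[ℂ] StrongDual ℂ X} (hD : M.dual.IsDerivation D)
    (h : ∃ f : StrongDual ℂ M.essentialPart, ∀ a (x : M.essentialPart),
      D a x = f (M.essentialRestrict.right a x) - f (M.essentialRestrict.left a x)) :
    M.dual.IsInner D := by
  obtain ⟨f₀, hf₀⟩ := h
  obtain ⟨f, hf, -⟩ := exists_extension_norm_eq M.essentialPart f₀
  -- Subtracting the inner derivation of the Hahn–Banach extension leaves a derivation that vanishes
  -- on `A X A`.
  have hder : M.dual.IsDerivation (D - (M.dual.left.flip f - M.dual.right.flip f)) := by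
    intro a b
    ext x
    have := congrArg (· x) (hD a b)
    simp only [add_apply, sub_apply, ContinuousLinearMap.flip_apply, dual_left_apply,
      dual_right_apply, M.left_mul, M.right_mul, map_sub, M.left_right] at this ⊢
    linear_combination this
  obtain ⟨g, hg⟩ := hder.isInner_of_forall_left_right_eq_zero fun a b c x ↦ by
    have := hf₀ a ⟨_, M.left_right_mem_essentialPart b c x⟩
    rw [← hf, ← hf] at this
    simp only [sub_apply, ContinuousLinearMap.flip_apply, dual_left_apply,
      dual_right_apply, coe_restrict_left, coe_restrict_right] at this ⊢
    rw [this, sub_self]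
  refine ⟨f + g, fun a ↦ ?_⟩
  have := hg a
  simp only [sub_apply, ContinuousLinearMap.flip_apply] at this
  rw [map_add, map_add, add_sub_add_comm, ← this]
  abel

end CStar

end BanachBimodule

/-! ### The characterization of amenability. -/

theorem corollaryC (A : Type u) [NonUnitalCStarAlgebra A] :
    IsAmenable A ↔
      ∀ (X : Type u) [NormedAddCommGroup X] [NormedSpace ℂ X] [CompleteSpace X]
        (M : BanachBimodule A X), M.IsEssential →
        ∀ D : A →L[ℂ] StrongDual ℂ X, M.dual.IsHyperlocal D →
          ∃ f g : StrongDual ℂ X, ∀ a : A, D a = M.dual.left a f - M.dual.right a g := by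
  constructor
  · intro hA X _ _ _ M hM D hD
    obtain ⟨g, hg⟩ := hD.exists_isDerivation_sub hM
    obtain ⟨f, hf⟩ := hA X M _ hg
    refine ⟨f + g, f, fun a ↦ ?_⟩
    have := hf a
    rw [sub_apply, ContinuousLinearMap.flip_apply, sub_eq_iff_eq_add] at this
    rw [this, map_add]
    abel
  · intro h X _ _ _ M D hD
    have : CompleteSpace M.essentialPart := M.isClosed_essentialPart.completeSpace_coe
    let D₀ : A →L[ℂ] StrongDual ℂ M.essentialPart :=
      ((ContinuousLinearMap.compL ℂ M.essentialPart X ℂ).flip M.essentialPart.subtypeL).comp D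
    have hD₀ : M.essentialRestrict.dual.IsDerivation D₀ := fun a b ↦ by
      ext x
      exact congrArg (· (x : X)) (hD a b)
    have hM := M.isEssential_essentialRestrict
    obtain ⟨f, g, hfg⟩ := h M.essentialPart M.essentialRestrict hM D₀ hD₀.isHyperlocal
    obtain ⟨f, hf⟩ := hD₀.isInner_of_isEssential hM hfg
    exact hD.isInner_of_essentialRestrict ⟨f, fun a x ↦ congrArg (· x) (hf a)⟩
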